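/- Let $n,k\ge 1$ be integers, $I=[0,1]$, $[m]=\{1,\dots,m\}$, and let $\mathcal K^n_k=\bigl\{\prod_{s=1}^n[\frac{j_s-1}{k},\frac{j_s}{k}] : j_1,\dots,j_n\in[k]\bigr\}$ be the division of $I^n$ into $k^n$ cubes. For $i\in[n]$ put $I^n_{i,-}=\{z\in I^n: z_i=0\}$ and $I^n_{i,+}=\{z\in I^n: z_i=1\}$. A set $A\subset I^n$ connects the $i$-th opposite faces if some connected $S\subset A$ meets both $I^n_{i,-}$ and $I^n_{i,+}$. For an integer $d\ge -1$ let $\mathrm{Skel}^{n,k}_d$ be the union, over all $K=\prod_{s}[\frac{j_s-1}{k},\frac{j_s}{k}]\in\mathcal K^n_k$, of the sets of those $x\in K$ for which $x_s\in\{\frac{j_s-1}{k},\frac{j_s}{k}\}$ for at least $n-d$ indices $s$ (so $\mathrm{Skel}^{n,k}_{-1}=\emptyset$). Let $\dim$ denote covering dimension, with $\dim\emptyset<0$. Let $F:\mathcal K^n_k\to[n]$ be any function, and let $A_i=\bigcup F^{-1}[\{i\}]$ for $i\in[n]$. Then: 1. there exists $i\in[n]$ such that $A_i\setminus \mathrm{Skel}^{n,k}_{i-2}$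 connects the $i$-th opposite faces of $I^n$; 2. (generalized $n$-dimensional Steinhaus chessboard theorem) there exist $i\in[n]$, $r\ge 1$ and cubes $P_1,\dots,P_r\in\mathcal K^n_k$ such that $F(P_j)=i$ for all $j\in[r]$, $P_1\cap I^n_{i,-}\neq\emptyset\neq P_r\cap I^n_{i,+}$, and $\dim(P_j\cap P_{j+1})\ge i-1$ for all $j\in[r-1]$. -/

import Mathlib

open Set

/-- `X` has covering (Lebesgue) dimension less than `n`: every finite open cover of `X` has a finite
open refinement covering `X` such that every point lies in at most `n` of its members.
For `n = 0` this says that `X` is empty. -/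
def HasCoveringDimensionLT (X : Type*) [TopologicalSpace X] (n : ℕ) : Prop :=
  ∀ 𝒰 : Set (Set X), 𝒰.Finite → (∀ U ∈ 𝒰, IsOpen U) → ⋃₀ 𝒰 = univ →
    ∃ 𝒱 : Set (Set X), 𝒱.Finite ∧ (∀ V ∈ 𝒱, IsOpen V) ∧ ⋃₀ 𝒱 = univ ∧
      (∀ V ∈ 𝒱, ∃ U ∈ 𝒰, V ⊆ U) ∧ ∀ x : X, {V ∈ 𝒱 | x ∈ V}.encard ≤ n

/-- The covering dimension of a topological space, with values in `WithBot ℕ∞`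
(the empty space, whose dimension is traditionally `-1`, has dimension `⊥`). -/
noncomputable def coveringDimension (X : Type*) [TopologicalSpace X] : WithBot ℕ∞ :=
  sInf {d | ∀ m : ℕ, d < m → HasCoveringDimensionLT X m}

namespace Chessboard

/-- The unit cube `I^n = [0, 1]^n`. -/
def unitCube (n : ℕ) : Set (Fin n → ℝ) := {z | ∀ s, 0 ≤ z s ∧ z s ≤ 1}

/-- The face `x_i = 0` of the unit cube. -/
def faceMinus (n : ℕ) (i : Fin n) : Set (Fin n → ℝ) := {z ∈ unitCube n | z i = 0}

/-- The face `x_i = 1` of the unit cube. -/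
def facePlus (n : ℕ) (i : Fin n) : Set (Fin n → ℝ) := {z ∈ unitCube n | z i = 1}

/-- The family of all subsets of the unit cube that connect its `i`-th opposite faces. -/
def Conn (n : ℕ) (i : Fin n) : Set (Set (Fin n → ℝ)) :=
  {A | A ⊆ unitCube n ∧ ∃ S ⊆ A, IsConnected S ∧
    (S ∩ faceMinus n i).Nonempty ∧ (S ∩ facePlus n i).Nonempty}

/-- The subcube `∏ₛ [jₛ / k, (jₛ + 1) / k]`, where `jₛ` runs over `0, …, k - 1`. -/
def subcube (n k : ℕ) (j : Fin n → Fin k) : Set (Fin n → ℝ) :=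
  {x | ∀ s, ((j s : ℕ) : ℝ) / k ≤ x s ∧ x s ≤ (((j s : ℕ) : ℝ) + 1) / k}

/-- The family of the `k ^ n` subcubes of the unit cube. -/
def subcubes (n k : ℕ) : Set (Set (Fin n → ℝ)) := Set.range (subcube n k)

/-- The `d`-skeleton of the subcube with index `j`: the points of the subcube that have at least
`n - d` coordinates at an endpoint of the corresponding edge. It is empty for `d < 0`. -/
def cubeSkeleton (n k : ℕ) (d : ℤ) (j : Fin n → Fin k) : Set (Fin n → ℝ) :=
  {x ∈ subcube n k j | ∃ S : Finset (Fin n), (n : ℤ) - d ≤ (S.card : ℤ) ∧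
    ∀ s ∈ S, x s = ((j s : ℕ) : ℝ) / k ∨ x s = (((j s : ℕ) : ℝ) + 1) / k}

/-- The union of the `d`-skeletons of all the subcubes. -/
def skeleton (n k : ℕ) (d : ℤ) : Set (Fin n → ℝ) := ⋃ j : Fin n → Fin k, cubeSkeleton n k d j

/-- The union of the subcubes of colour `i`. -/
def colourUnion {n k : ℕ} (F : subcubes n k → Fin n) (i : Fin n) : Set (Fin n → ℝ) :=
  ⋃ P ∈ F ⁻¹' {i}, (P : Set (Fin n → ℝ))

end Chessboard

/-! Colour `i : Fin n` is counted from `0`, so consecutive cubes of a chain of colour `i` must share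
a face of dimension at least `i`. Both conclusions follow from one chain, given by
`exists_chain_of_colouring`.

That result is a parity argument on cochains mod 2 of the cubical grid. `facetSum` is the coboundary
and squares to zero. For weights `w i` equal to `1` on the side `x i = 0` and to `0` on the opposite
side, a discrete Stokes argument (`sum_chainCount_flag`) makes the total of `chainCount w n` over
all cubes odd. So some cube has nonzero count, and then for every `i < n` it has two faces of
dimensions `i` and `i + 1` with different `w i` (`exists_flag_of_chainCount_ne_zero`). Take for `w
i` the indicator of the part reachable from the side `x i = 0` by chains of colour `i`. If no chain
reaches the opposite side, the weights are admissible; but on the faces of dimension at least `i` of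
a cube of colour `i` this indicator is constant, a contradiction.

The dimension bound needs Lebesgue's covering theorem, itself deduced from the combinatorial result.
Connectedness outside the skeleton comes from gluing star-shaped cores of the cubes. -/

namespace Chessboard

/-! ### Cubical cochains mod 2 and weighted chain counts -/

/-- The sum mod 2 of `f` over the facets of the face `v` of the cubical grid. A face is encoded by
`v : Fin n → ℤ`, an even coordinate `2 a` standing for `{a}` and an odd coordinate `2 a + 1` for
`[a, a + 1]`. -/
def facetSum {n : ℕ} (f : (Fin n → ℤ) → ZMod 2) (v : Fin n → ℤ) : ZMod 2 :=
  ∑ s, if Odd (v s) then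
    f (Function.update v s (v s + 1)) + f (Function.update v s (v s - 1)) else 0

lemma sum_sum_eq_zero_of_symm {ι : Type*} [Fintype ι] (g : ι → ι → ZMod 2)
    (hs : ∀ s t, g s t = g t s) (hd : ∀ s, g s s = 0) : ∑ s, ∑ t, g s t = 0 := by
  classical
  rw [← Finset.sum_product']
  refine Finset.sum_involution (fun a _ => a.swap) ?_ ?_ ?_ ?_
  · rintro ⟨a, b⟩ _
    simp only [Prod.swap_prod_mk, hs b a]
    exact CharTwo.add_self_eq_zero _
  · rintro ⟨a, b⟩ _ h he
    simp only [Prod.swap_prod_mk, Prod.mk.injEq] at he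
    rw [he.1] at h
    exact h (hd _)
  · simp
  · simp

/-- Each codimension-two face is reached by collapsing two directions in either order, so its
contributions cancel mod 2. -/
lemma facetSum_facetSum {n : ℕ} (f : (Fin n → ℤ) → ZMod 2) (v : Fin n → ℤ) :
    facetSum (facetSum f) v = 0 := by
  let F (s t : Fin n) (a b : ℤ) : ZMod 2 := f (Function.update (Function.update v s a) t b)
  let g (s t : Fin n) : ZMod 2 := if s ≠ t ∧ Odd (v s) ∧ Odd (v t) then
    F s t (v s + 1) (v t + 1) + F s t (v s + 1) (v t - 1) +
      (F s t (v s - 1) (v t + 1) + F s t (v s - 1) (v t - 1)) else 0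
  have key : facetSum (facetSum f) v = ∑ s, ∑ t, g s t := by
    unfold facetSum
    refine Finset.sum_congr rfl fun s _ => ?_
    split_ifs with hs
    · rw [← Finset.sum_add_distrib]
      refine Finset.sum_congr rfl fun t _ => ?_
      rcases eq_or_ne s t with rfl | hst
      · have h1 : ¬ Odd (v s + 1) := by grind
        have h2 : ¬ Odd (v s - 1) := by grind
        simp [g, h1, h2]
      · by_cases ht : Odd (v t) <;>
          simp [g, F, hst, hst.symm, hs, ht]
    · simp [g, hs]
  rw [key]
  refine sum_sum_eq_zero_of_symm g (fun s t => ?_) (fun s => by simp [g])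
  rcases eq_or_ne s t with rfl | hst
  · rfl
  · have hF : ∀ a b, F s t a b = F t s b a := fun a b => by
      simp only [F]
      rw [Function.update_comm hst]
    simp only [g, hF]
    by_cases h1 : Odd (v s) <;> by_cases h2 : Odd (v t) <;> simp [h1, h2, hst, hst.symm]
    ring

/-- The number mod 2 of chains `v₀ ⊂ ⋯ ⊂ v_d = v` of faces of successive dimensions,
weighted by the product of the `w i (v i)` for `i < d`. -/
def chainCount {n : ℕ} (w : ℕ → (Fin n → ℤ) → ZMod 2) : ℕ → (Fin n → ℤ) → ZMod 2
  | 0 => fun _ => 1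
  | d + 1 => facetSum fun x => w d x * chainCount w d x

section chainCount

variable {n : ℕ} (w : ℕ → (Fin n → ℤ) → ZMod 2)

lemma facetSum_chainCount (d : ℕ) (v : Fin n → ℤ) : facetSum (chainCount w d) v = 0 := by
  cases d with
  | zero =>
    refine Finset.sum_eq_zero fun s _ => ?_
    simp only [chainCount]
    split_ifs
    · exact CharTwo.add_self_eq_zero _
    · rfl
  | succ d => exact facetSum_facetSum _ v

lemma facetSum_congr_of_coord {f g : (Fin n → ℤ) → ZMod 2} {s : Fin n} {v : Fin n → ℤ}
    (hv : Even (v s)) (h : ∀ x, x s = v s → f x = g x) : facetSum f v = facetSum g v := by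
  refine Finset.sum_congr rfl fun t _ => ?_
  split_ifs with ht
  · have hst : s ≠ t := by
      rintro rfl
      exact Int.not_even_iff_odd.2 ht hv
    rw [h, h] <;> simp [hst]
  · rfl

lemma facetSum_zero (v : Fin n → ℤ) : facetSum (fun _ => 0) v = 0 := by
  simp [facetSum]

/-- Facets of a face in the hyperplane `x s = a` stay in it, as `a` is even. At level `s + 1` the
constant weight factors out, leaving the coboundary of a cocycle; the vanishing then passes to
higher levels. -/
lemma chainCount_eq_zero_of_coord {a : ℤ} (ha : Even a) {s : Fin n} {c : ZMod 2}
    (h : ∀ x : Fin n → ℤ, x s = a → w s x = c) {d : ℕ} (hd : (s : ℕ) < d)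
    (v : Fin n → ℤ) (hv : v s = a) : chainCount w d v = 0 := by
  induction d generalizing v with
  | zero => omega
  | succ d ih =>
    rcases Nat.lt_succ_iff_lt_or_eq.1 hd with hd | hd
    · rw [chainCount, facetSum_congr_of_coord (s := s) (g := fun _ => 0) (hv ▸ ha),
        facetSum_zero]
      intro x hx
      rw [ih hd x (hx.trans hv), mul_zero]
    · subst hd
      rw [chainCount, facetSum_congr_of_coord (s := s) (g := fun x => c * chainCount w s x)
        (hv ▸ ha) (fun x hx => by rw [h x (hx.trans hv)])]
      have : facetSum (fun x => c * chainCount w s x) v = c * facetSum (chainCount w s) v := by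
        simp [facetSum, Finset.mul_sum, mul_add]
      rw [this, facetSum_chainCount, mul_zero]

/-- The odd numbers between `0` and `2 k`. -/
def odds (k : ℕ) : Finset ℤ := (Finset.range k).image fun a : ℕ => 2 * (a : ℤ) + 1

lemma sum_odds (k : ℕ) (f : ℤ → ZMod 2) :
    ∑ b ∈ odds k, (f (b + 1) + f (b - 1)) = f 0 + f (2 * k) := by
  rw [odds, Finset.sum_image (by intro a _ b _ h; simpa using h)]
  induction k with
  | zero => simp [CharTwo.add_self_eq_zero]
  | succ k ih =>
    rw [Finset.sum_range_succ, ih]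
    have h1 : (2 * (k : ℤ) + 1 + 1) = 2 * ((k + 1 : ℕ) : ℤ) := by push_cast; ring
    have h2 : (2 * (k : ℤ) + 1 - 1) = 2 * (k : ℤ) := by ring
    rw [h1, h2]
    have := CharTwo.add_self_eq_zero (f (2 * (k : ℤ)))
    linear_combination this

lemma sum_piFinset_eq_sum_update (T : Fin n → Finset ℤ) (s : Fin n) (f : (Fin n → ℤ) → ZMod 2) :
    ∑ v ∈ Fintype.piFinset T, f v =
      ∑ x ∈ Fintype.piFinset (Function.update T s {0}), ∑ b ∈ T s, f (Function.update x s b) := by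
  rw [← Finset.sum_product']
  refine Finset.sum_bij' (fun v _ => (Function.update v s 0, v s))
    (fun y _ => Function.update y.1 s y.2) ?_ ?_ ?_ ?_ ?_
  · intro v hv
    simp only [Fintype.mem_piFinset, Finset.mem_product] at hv ⊢
    refine ⟨fun t => ?_, hv s⟩
    rcases eq_or_ne t s with rfl | h <;> simp [*]
  · rintro ⟨x, b⟩ hx
    simp only [Fintype.mem_piFinset, Finset.mem_product] at hx ⊢
    intro t
    have := hx.1 t
    rcases eq_or_ne t s with rfl | h <;> simp_all
  · simp
  · rintro ⟨x, b⟩ hx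
    simp only [Fintype.mem_piFinset, Finset.mem_product] at hx ⊢
    have := hx.1 s
    simp at this
    simp [← this]
  · simp

/-- The coordinate sets of the faces `[·] × ⋯ × [·] × {0} × ⋯ × {0}` with `d` intervals. -/
def flag (n k d : ℕ) (s : Fin n) : Finset ℤ := if (s : ℕ) < d then odds k else {0}

lemma sum_chainCount_flag {k : ℕ} (h0 : ∀ (i : Fin n) (x : Fin n → ℤ), x i = 0 → w i x = 1)
    (h1 : ∀ (i : Fin n) (x : Fin n → ℤ), x i = 2 * k → w i x = 0) {d : ℕ} (hd : d ≤ n) :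
    ∑ v ∈ Fintype.piFinset (flag n k d), chainCount w d v = 1 := by
  induction d with
  | zero =>
    have : flag n k 0 = fun _ => {0} := by ext; simp [flag]
    simp [this, chainCount]
  | succ d ih =>
    specialize ih (by omega)
    set f : (Fin n → ℤ) → ZMod 2 := fun x => w d x * chainCount w d x with hf
    have odd_odds : ∀ b ∈ odds k, Odd b := by
      intro b hb
      obtain ⟨a, -, rfl⟩ := Finset.mem_image.1 hb
      exact ⟨a, rfl⟩
    have step : ∀ s : Fin n, ∑ v ∈ Fintype.piFinset (flag n k (d + 1)),
        (if Odd (v s) then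
          f (Function.update v s (v s + 1)) + f (Function.update v s (v s - 1)) else 0) =
        if (s : ℕ) = d then 1 else 0 := by
      intro s
      by_cases hs : (s : ℕ) < d + 1
      · rw [sum_piFinset_eq_sum_update _ s]
        have hT : flag n k (d + 1) s = odds k := by simp [flag, hs]
        have h2 : ∀ x : Fin n → ℤ, ∑ b ∈ flag n k (d + 1) s,
            (if Odd (Function.update x s b s) then
              f (Function.update (Function.update x s b) s (Function.update x s b s + 1)) +
              f (Function.update (Function.update x s b) s (Function.update x s b s - 1)) else 0) =
            f (Function.update x s 0) + f (Function.update x s (2 * k)) := by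
          intro x
          rw [hT, ← sum_odds k fun b => f (Function.update x s b)]
          refine Finset.sum_congr rfl fun b hb => ?_
          simp [odd_odds b hb]
        rw [Finset.sum_congr rfl fun x _ => h2 x]
        -- After telescoping only the two sides in direction `s` remain. For `s < d` the count
        -- vanishes on both; for `s = d` the weight keeps only the side `0`, which gives the sum one
        -- level lower.
        rcases Nat.lt_succ_iff_lt_or_eq.1 hs with hsd | hsd
        · rw [if_neg hsd.ne]
          refine Finset.sum_eq_zero fun x _ => ?_
          simp only [hf]
          rw [chainCount_eq_zero_of_coord w Even.zero (h0 s) hsd _ (by simp),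
            chainCount_eq_zero_of_coord w (even_two_mul _) (h1 s) hsd _ (by simp)]
          simp
        · subst hsd
          rw [if_pos rfl, ← ih]
          have hfl : Function.update (flag n k (s + 1)) s {0} = flag n k s := by
            funext t
            rcases eq_or_ne t s with rfl | h
            · simp [flag]
            · have : (t : ℕ) ≠ s := fun e => h (Fin.ext e)
              rw [Function.update_of_ne h]
              simp only [flag]
              congr 1
              simp only [eq_iff_iff]
              omega
          rw [hfl]
          refine Finset.sum_congr rfl fun x hx => ?_
          have hx0 : x s = 0 := by simpa [flag] using Fintype.mem_piFinset.1 hx s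
          simp only [hf]
          rw [h1 s (Function.update x s (2 * k)) (by simp)]
          have : Function.update x s 0 = x := by rw [← hx0]; simp
          rw [this, h0 s x hx0]
          simp
      · rw [if_neg (by omega)]
        refine Finset.sum_eq_zero fun x hx => ?_
        have hx0 : x s = 0 := by simpa [flag, hs] using Fintype.mem_piFinset.1 hx s
        simp [hx0]
    simp only [chainCount, facetSum]
    rw [Finset.sum_comm, Finset.sum_congr rfl fun s _ => step s,
      Finset.sum_eq_single (⟨d, by omega⟩ : Fin n)]
    · simp
    · intro b _ hb
      rw [if_neg fun e => hb (Fin.ext e)]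
    · simp

lemma exists_chainCount_ne_zero {k : ℕ} (h0 : ∀ (i : Fin n) (x : Fin n → ℤ), x i = 0 → w i x = 1)
    (h1 : ∀ (i : Fin n) (x : Fin n → ℤ), x i = 2 * k → w i x = 0) :
    ∃ a : Fin n → Fin k, chainCount w n (fun s => 2 * ((a s : ℕ) : ℤ) + 1) ≠ 0 := by
  have h := sum_chainCount_flag w h0 h1 le_rfl
  obtain ⟨v, hv, hne⟩ := Finset.exists_ne_zero_of_sum_ne_zero (h ▸ one_ne_zero)
  have : ∀ s, ∃ a : Fin k, v s = 2 * ((a : ℕ) : ℤ) + 1 := by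
    intro s
    have hs := Fintype.mem_piFinset.1 hv s
    simp only [flag, s.2, if_true, odds, Finset.mem_image, Finset.mem_range] at hs
    obtain ⟨a, ha, e⟩ := hs
    exact ⟨⟨a, ha⟩, e.symm⟩
  choose a ha using this
  refine ⟨a, ?_⟩
  rwa [← funext ha]

/-- `u` is a face of `v`. -/
def IsFace (u v : Fin n → ℤ) : Prop :=
  ∀ s, u s = v s ∨ (Odd (v s) ∧ Even (u s) ∧ |u s - v s| = 1)

lemma IsFace.refl (u : Fin n → ℤ) : IsFace u u := fun _ => Or.inl rfl

lemma IsFace.trans {u v x : Fin n → ℤ} (h : IsFace u v) (h' : IsFace v x) : IsFace u x := by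
  intro s
  have := h s
  have := h' s
  grind

lemma isFace_update {v : Fin n → ℤ} {s : Fin n} (hs : Odd (v s)) {a : ℤ} (ha : |a - v s| = 1) :
    IsFace (Function.update v s a) v := by
  intro t
  rcases eq_or_ne t s with rfl | h
  · right
    simp only [Function.update_self]
    refine ⟨hs, ?_, ha⟩
    grind
  · simp [h]

/-- The dimension of a face. -/
noncomputable def faceDim (v : Fin n → ℤ) : ℕ := {s | Odd (v s)}.ncard

lemma faceDim_update {v : Fin n → ℤ} {s : Fin n} (hs : Odd (v s)) {a : ℤ} (ha : |a - v s| = 1) :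
    faceDim (Function.update v s a) + 1 = faceDim v := by
  have hE : ¬ Odd a := by grind
  have : {t | Odd (Function.update v s a t)} = {t | Odd (v t)} \ {s} := by
    ext t
    rcases eq_or_ne t s with rfl | h <;> simp [*]
  rw [faceDim, this, faceDim]
  exact Set.ncard_sdiff_singleton_add_one hs (Set.toFinite _)

lemma exists_facet_of_facetSum_ne_zero {f : (Fin n → ℤ) → ZMod 2} {v : Fin n → ℤ}
    (h : facetSum f v ≠ 0) : ∃ u, f u ≠ 0 ∧ IsFace u v ∧ faceDim u + 1 = faceDim v := by
  obtain ⟨s, -, hs⟩ := Finset.exists_ne_zero_of_sum_ne_zero h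
  have hodd : Odd (v s) := by
    by_contra hc
    simp [hc] at hs
  rw [if_pos hodd] at hs
  by_cases h1 : f (Function.update v s (v s + 1)) = 0
  · rw [h1, zero_add] at hs
    exact ⟨_, hs, isFace_update hodd (by simp), faceDim_update hodd (by simp)⟩
  · exact ⟨_, h1, isFace_update hodd (by simp), faceDim_update hodd (by simp)⟩

/-- Since `chainCount w d` is a cocycle, the weight may be shifted by the constant `w d v`; a
surviving term then has `w d u ≠ w d v`. -/
lemma exists_facet_of_chainCount_ne_zero {d : ℕ} {v : Fin n → ℤ} (h : chainCount w (d + 1) v ≠ 0) :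
    ∃ u, chainCount w d u ≠ 0 ∧ w d u ≠ w d v ∧ IsFace u v ∧ faceDim u + 1 = faceDim v := by
  have : chainCount w (d + 1) v = facetSum (fun x => (w d x - w d v) * chainCount w d x) v := by
    have h2 : facetSum (fun x => (w d x - w d v) * chainCount w d x) v =
        facetSum (fun x => w d x * chainCount w d x) v
          - w d v * facetSum (chainCount w d) v := by
      simp only [facetSum, Finset.mul_sum, ← Finset.sum_sub_distrib]
      refine Finset.sum_congr rfl fun s _ => ?_
      split_ifs <;> ring
    rw [h2, facetSum_chainCount, mul_zero, sub_zero, chainCount]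
  rw [this] at h
  obtain ⟨u, hu, h3, h4⟩ := exists_facet_of_facetSum_ne_zero h
  refine ⟨u, right_ne_zero_of_mul hu, fun e => hu (by simp [e]), h3, h4⟩

lemma exists_flag_of_chainCount_ne_zero {d : ℕ} {v : Fin n → ℤ} (h : chainCount w d v ≠ 0)
    {i : ℕ} (hi : i < d) : ∃ u u', w i u ≠ w i u' ∧ IsFace u v ∧ IsFace u' v ∧
      faceDim v = faceDim u + (d - i) ∧ faceDim u' = faceDim u + 1 := by
  induction d generalizing v with
  | zero => omega
  | succ d ih =>
    obtain ⟨u, h1, h2, h3, h4⟩ := exists_facet_of_chainCount_ne_zero w h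
    rcases Nat.lt_succ_iff_lt_or_eq.1 hi with hi | rfl
    · obtain ⟨x, x', g1, g2, g3, g4, g5⟩ := ih h1 hi
      exact ⟨x, x', g1, g2.trans h3, g3.trans h3, by omega, g5⟩
    · exact ⟨u, v, h2, h3, IsFace.refl v, by omega, h4.symm⟩

end chainCount

/-! ### The combinatorial chessboard theorem -/

/-- Two subcubes, given by their indices, meet in a set of dimension at least `d`. -/
def Adjacent {n k : ℕ} (d : ℕ) (a b : Fin n → Fin k) : Prop :=
  (∀ s, (a s : ℕ) ≤ b s + 1 ∧ (b s : ℕ) ≤ a s + 1) ∧ d ≤ {s | a s = b s}.ncard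

/-- Combinatorial form of the generalized Steinhaus chessboard theorem. -/
theorem exists_chain_of_colouring {n k : ℕ} (hk : 1 ≤ k) (F : (Fin n → Fin k) → Fin n) :
    ∃ (i : Fin n) (a b : Fin n → Fin k), F a = i ∧ (a i : ℕ) = 0 ∧ (b i : ℕ) + 1 = k ∧
      Relation.ReflTransGen (fun x y => F y = i ∧ Adjacent i x y) a b := by
  classical
  by_contra! hcon
  let face (a : Fin n → Fin k) : Fin n → ℤ := fun s => 2 * ((a s : ℕ) : ℤ) + 1
  let Good (i : Fin n) (b : Fin n → Fin k) : Prop := ∃ a, F a = i ∧ (a i : ℕ) = 0 ∧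
      Relation.ReflTransGen (fun x y => F y = i ∧ Adjacent i x y) a b
  -- A face counts as reachable only through a subface of dimension at least `i`: such a common
  -- subface makes two cubes adjacent at level `i`.
  let W (i : Fin n) (x : Fin n → ℤ) : Prop := x i = 0 ∨
    ∃ t, IsFace t x ∧ (i : ℕ) ≤ faceDim t ∧ ∃ g, Good i g ∧ IsFace t (face g)
  let w (d : ℕ) (x : Fin n → ℤ) : ZMod 2 := if h : d < n then if W ⟨d, h⟩ x then 1 else 0 else 0
  have hw : ∀ (i : Fin n) x, w i x = if W i x then 1 else 0 := fun i x => by simp [w]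
  obtain ⟨a, ha⟩ := exists_chainCount_ne_zero (k := k) w
    (fun i x hx => by rw [hw, if_pos (Or.inl hx)]) (fun i x hx => by
      rw [hw, if_neg]
      rintro (h | ⟨t, ht, -, g, ⟨a, h1, h2, h3⟩, hg⟩)
      · omega
      · refine hcon i a g h1 h2 ?_ h3
        have e1 := ht i
        have e2 := hg i
        have e3 := (g i).2
        simp only [face] at e2
        clear * - e1 e2 e3 hx
        grind)
  have hdim : faceDim (face a) = n := by
    have : {s | Odd (face a s)} = univ := by
      ext s
      simp [face]
    rw [faceDim, this, Set.ncard_univ, Nat.card_eq_fintype_card, Fintype.card_fin]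
  -- On the faces of `a` of dimension at least `F a`, reachability depends only on `a`. This
  -- contradicts the change of `w` between dimensions `F a` and `F a + 1`.
  have key : ∀ u, IsFace u (face a) → (F a : ℕ) ≤ faceDim u → (W (F a) u ↔ Good (F a) a) := by
    intro u hu hd
    constructor
    · rintro (h | ⟨t, ht, htd, g, ⟨b, h1, h2, h3⟩, hg⟩)
      · refine ⟨a, rfl, ?_, .refl⟩
        have e := hu (F a)
        simp only [face] at e
        clear * - e h
        grind
      · refine ⟨b, h1, h2, h3.tail ⟨rfl, ?_, ?_⟩⟩
        · intro s
          have e1 := (ht.trans hu) s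
          have e2 := hg s
          simp only [face] at e1 e2
          clear * - e1 e2
          grind
        · refine htd.trans (Set.ncard_le_ncard (fun s hs => ?_) (Set.toFinite _))
          have h4 := (ht.trans hu) s
          have h5 := hg s
          simp only [face, mem_ofPred_eq] at hs h4 h5 ⊢
          apply Fin.ext
          clear * - hs h4 h5
          grind
    · intro h
      exact Or.inr ⟨u, IsFace.refl u, hd, a, h, hu⟩
  obtain ⟨u, u', h1, h2, h3, h4, h5⟩ := exists_flag_of_chainCount_ne_zero w ha (F a).2
  have h6 : faceDim u = F a := by
    have := (F a).2
    have h4' : faceDim (face a) = _ := h4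
    omega
  apply h1
  rw [hw, hw]
  congr 1
  rw [key u h2 h6.ge, key u' h3 (by omega)]

/-! ### Lebesgue's covering theorem -/

lemma subcube_corner_mem {m k : ℕ} (a : Fin m → Fin k) {ε : Fin m → ℝ}
    (hε : ∀ s, 0 ≤ ε s ∧ ε s ≤ 1) : (fun s => (((a s : ℕ) : ℝ) + ε s) / k) ∈ unitCube m := by
  intro s
  have h1 : ((a s : ℕ) : ℝ) + 1 ≤ k := by exact_mod_cast (a s).2
  have h2 : (0 : ℝ) ≤ ((a s : ℕ) : ℝ) := Nat.cast_nonneg _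
  have h3 := hε s
  exact ⟨by positivity [h3.1], div_le_one_of_le₀ (by linarith) (by linarith)⟩

/-- Lebesgue's covering theorem: a space that has the cube `[0, 1]^m` as a retract has covering
dimension at least `m`. -/
theorem not_hasCoveringDimensionLT {X : Type*} [TopologicalSpace X] {m : ℕ}
    (f : unitCube m → X) (hf : Continuous f) (g : X → Fin m → ℝ) (hg : Continuous g)
    (hgf : ∀ z, g (f z) = z) : ¬ HasCoveringDimensionLT X m := by
  classical
  intro hX
  -- No `U ε` contains points with `g x s = 0` and `g x s = 1` for the same `s`.
  let U (ε : Fin m → Bool) : Set X := {x | ∀ s, if ε s then g x s < 1 else 0 < g x s}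
  obtain ⟨𝒱, hfin, hopen, hcov, href, hord⟩ := hX (Set.range U) (Set.finite_range U) (by
      rintro _ ⟨ε, rfl⟩
      simp only [U, ofPred_forall]
      refine isOpen_iInter_of_finite fun s => ?_
      cases ε s
      · simpa using isOpen_lt continuous_const ((continuous_apply s).comp hg)
      · simpa using isOpen_lt ((continuous_apply s).comp hg) continuous_const) (by
      refine eq_univ_of_forall fun x => ?_
      refine ⟨_, ⟨fun s => decide (g x s < 1), rfl⟩, fun s => ?_⟩
      by_cases h : g x s < 1
      · simp [h]
      · simp only [h, decide_false]
        simp only [Bool.false_eq_true, if_false]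
        linarith)
  let ρ (V : Set X) (z : unitCube m) : ENNReal := Metric.infEDist z (f ⁻¹' V)ᶜ
  have hρ : ∀ V ∈ 𝒱, ∀ z, 0 < ρ V z ↔ f z ∈ V := by
    intro V hV z
    have hc : IsClosed (f ⁻¹' V)ᶜ := ((hopen V hV).preimage hf).isClosed_compl
    have := Metric.mem_iff_infEDist_zero_of_closed hc (x := z)
    rw [pos_iff_ne_zero, ne_eq, ← this]
    simp
  -- Here the members of `T` strictly dominate all others. Distinct `T` of equal size give disjoint
  -- sets, since otherwise some `V` and `W` would each dominate the other. Those with `1 ≤ T.card ≤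
  -- m` cover, by taking all members of `𝒱` containing `f z`.
  let D (T : Finset (Set X)) : Set (unitCube m) :=
    {z | ∀ V ∈ T, 0 < ρ V z ∧ ∀ W ∈ hfin.toFinset, W ∉ T → ρ W z < ρ V z}
  have hDopen : ∀ T, IsOpen (D T) := by
    intro T
    have : D T = ⋂ V ∈ T, ({z | 0 < ρ V z} ∩
        ⋂ W ∈ hfin.toFinset, {z | W ∉ T → ρ W z < ρ V z}) := by
      ext z
      simp [D]
    rw [this]
    refine isOpen_biInter_finset fun V _ =>
      (isOpen_lt continuous_const Metric.continuous_infEDist).inter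
        (isOpen_biInter_finset fun W _ => ?_)
    by_cases hW : W ∈ T
    · simp [hW]
    · simpa [hW] using isOpen_lt Metric.continuous_infEDist Metric.continuous_infEDist
  have hDdisj : ∀ T T' z, T ⊆ hfin.toFinset → T' ⊆ hfin.toFinset → T.card = T'.card →
      z ∈ D T → z ∈ D T' → T = T' := by
    intro T T' z hT hT' hc hz hz'
    by_contra hne
    obtain ⟨V, hV, hV'⟩ := Finset.not_subset.1
      fun h => hne (Finset.eq_of_subset_of_card_le h hc.ge)
    obtain ⟨W, hW, hW'⟩ := Finset.not_subset.1
      fun h => hne (Finset.eq_of_subset_of_card_le h hc.le).symm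
    exact lt_asymm ((hz V hV).2 W (hT' hW) hW') ((hz' W hW).2 V (hT hV) hV')
  let J := {T : Finset (Set X) // T ⊆ hfin.toFinset ∧ T.Nonempty ∧ T.card ≤ m}
  have hDcov : (univ : Set (unitCube m)) ⊆ ⋃ T : J, D T.1 := by
    intro z _
    have hx : f z ∈ ⋃₀ 𝒱 := hcov ▸ mem_univ _
    obtain ⟨V, hV, hzV⟩ := hx
    refine mem_iUnion.2 ⟨⟨hfin.toFinset.filter (f z ∈ ·), Finset.filter_subset _ _,
      ⟨V, by simp [hV, hzV]⟩, ?_⟩, ?_⟩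
    · have h1 := hord (f z)
      have h2 : {V ∈ 𝒱 | f z ∈ V} = ((hfin.toFinset.filter (f z ∈ ·) : Finset (Set X)) : Set _) := by
        ext
        simp
      rw [h2, Set.encard_coe_eq_coe_finsetCard] at h1
      exact_mod_cast h1
    · intro V hV
      simp only [Finset.mem_filter, Finite.mem_toFinset] at hV
      have hpos := (hρ V hV.1 z).2 hV.2
      refine ⟨hpos, fun W hW hW' => ?_⟩
      rw [Finite.mem_toFinset] at hW
      have : ¬ 0 < ρ W z := fun h => hW' (by simp [hW, (hρ W hW z).1 h])
      rw [not_lt, nonpos_iff_eq_zero] at this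
      rwa [this]
  have hcompact : CompactSpace (unitCube m) := by
    have : unitCube m = Set.pi univ fun _ => Icc 0 1 := by
      ext z
      simp [unitCube, Pi.le_def, forall_and]
    rw [← isCompact_iff_compactSpace, this]
    exact isCompact_univ_pi fun _ => isCompact_Icc
  obtain ⟨δ, hδ, hball⟩ := lebesgue_number_lemma_of_metric isCompact_univ
    (fun T : J => hDopen T.1) hDcov
  obtain ⟨k, hk⟩ := exists_nat_one_div_lt hδ
  let z (a : Fin m → Fin (k + 1)) (ε : Fin m → ℝ) (hε : ∀ s, 0 ≤ ε s ∧ ε s ≤ 1) : unitCube m :=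
    ⟨_, subcube_corner_mem a hε⟩
  have h0 : ∀ s : Fin m, (0 : ℝ) ≤ (fun _ => 0 : Fin m → ℝ) s ∧ (fun _ => 0 : Fin m → ℝ) s ≤ 1 :=
    fun _ => by simp
  have h1 : ∀ s : Fin m, (0 : ℝ) ≤ (fun _ => 1 : Fin m → ℝ) s ∧ (fun _ => 1 : Fin m → ℝ) s ≤ 1 :=
    fun _ => by simp
  choose T hT using fun a => hball (z a _ h0) (mem_univ _)
  have hcard : ∀ a, (T a).1.card - 1 < m := fun a => by
    have := (T a).2.2.2
    have := (T a).2.2.1.card_pos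
    omega
  have hkpos : (0 : ℝ) < ((k + 1 : ℕ) : ℝ) := by positivity
  have hsmall : ∀ (x y : unitCube m), (∀ s, |(x.1 s - y.1 s) * ((k + 1 : ℕ) : ℝ)| ≤ 1) →
      x ∈ Metric.ball y δ := by
    intro x y h
    rw [Metric.mem_ball, Subtype.dist_eq]
    refine lt_of_le_of_lt ((dist_pi_le_iff (by positivity)).2 fun s => ?_) hk
    rw [Real.dist_eq, le_div_iff₀ (by positivity)]
    have := h s
    rw [abs_mul, abs_of_pos hkpos] at this
    exact_mod_cast this
  -- The colour of a cube is `T.card - 1`. Lower corners of adjacent cubes are closer than `δ`, so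
  -- disjointness keeps `T` itself constant along the chain, and any `V ∈ T` then meets both
  -- opposite sides.
  obtain ⟨i, a, b, hai, ha, hb, hab⟩ := exists_chain_of_colouring (Nat.le_add_left 1 k)
    (fun a => (⟨(T a).1.card - 1, hcard a⟩ : Fin m))
  have hchain : T b = T a ∧ (T b).1.card - 1 = i := by
    clear hb
    induction hab with
    | refl => exact ⟨rfl, congrArg Fin.val hai⟩
    | @tail b c _ hbc ih =>
      have hc : (T b).1.card = (T c).1.card := by
        have h2 := congrArg Fin.val hbc.1
        simp only at h2
        have := ih.2
        have := (T b).2.2.1.card_pos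
        have := (T c).2.2.1.card_pos
        omega
      refine ⟨?_, congrArg Fin.val hbc.1⟩
      rw [← ih.1]
      refine Subtype.ext (hDdisj _ _ (z b _ h0) (T c).2.1 (T b).2.1 hc.symm
        (hT c (hsmall _ _ fun s => ?_)) (hT b (Metric.mem_ball_self hδ)))
      simp only [z]
      rw [← sub_div, div_mul_cancel₀ _ hkpos.ne', abs_le]
      obtain ⟨h3, h4⟩ := hbc.2.1 s
      have h3' : ((b s : ℕ) : ℝ) ≤ (c s : ℕ) + 1 := by exact_mod_cast h3
      have h4' : ((c s : ℕ) : ℝ) ≤ (b s : ℕ) + 1 := by exact_mod_cast h4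
      constructor <;> linarith
  obtain ⟨V, hV⟩ := (T a).2.2.1
  have hVm : V ∈ 𝒱 := by simpa using (T a).2.1 hV
  obtain ⟨_, ⟨ε, rfl⟩, hVU⟩ := href V hVm
  have hx : f (z a _ h0) ∈ V :=
    (hρ V hVm _).1 (hT a (Metric.mem_ball_self hδ) V hV).1
  have hy : f (z b _ h1) ∈ V := by
    refine (hρ V hVm _).1 (hT b (hsmall _ _ fun s => ?_) V (hchain.1 ▸ hV)).1
    simp only [z]
    rw [← sub_div, div_mul_cancel₀ _ hkpos.ne']
    simp
  have hx' := hVU hx i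
  have hy' := hVU hy i
  rw [hgf] at hx' hy'
  have hb' : ((b i : ℕ) : ℝ) + 1 = ((k + 1 : ℕ) : ℝ) := by exact_mod_cast hb
  simp only [z, ha, hb'] at hx' hy'
  rw [div_self hkpos.ne'] at hy'
  cases h : ε i <;> simp [h] at hx' hy'

theorem le_coveringDimension {X : Type*} [TopologicalSpace X] {m : ℕ}
    (f : unitCube m → X) (hf : Continuous f) (g : X → Fin m → ℝ) (hg : Continuous g)
    (hgf : ∀ z, g (f z) = z) : ((m : ℕ∞) : WithBot ℕ∞) ≤ coveringDimension X := by
  refine le_sInf fun d hd => ?_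
  by_contra! h
  exact not_hasCoveringDimensionLT f hf g hg hgf (hd m h)

/-! ### Intersections and cores of subcubes -/

lemma mem_subcube_iff {n k : ℕ} (a : Fin n → Fin k) (x : Fin n → ℝ) :
    x ∈ subcube n k a ↔ ∀ s, ((a s : ℕ) : ℝ) ≤ x s * k ∧ x s * k ≤ (a s : ℕ) + 1 := by
  refine forall_congr' fun s => ?_
  have hk : (0 : ℝ) < k := by
    have := (a s).pos
    positivity
  rw [div_le_iff₀ hk, le_div_iff₀ hk]

/-- Choosing `i` coordinates on which the indices agree embeds an `i`-cube in the intersection;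
rescaled projection to them is the retraction. -/
lemma Adjacent.le_coveringDimension {n k i : ℕ} {a b : Fin n → Fin k} (h : Adjacent i a b) :
    ((i : ℕ∞) : WithBot ℕ∞) ≤
      coveringDimension (subcube n k a ∩ subcube n k b : Set (Fin n → ℝ)) := by
  classical
  obtain ⟨hab, hi⟩ := h
  obtain ⟨e⟩ : Nonempty (Fin i ↪ {s | a s = b s}) := by
    refine Function.Embedding.nonempty_of_card_le ?_
    rwa [Fintype.card_fin, ← Nat.card_eq_fintype_card, Nat.card_coe_set_eq]
  let x (z : Fin i → ℝ) : Fin n → ℝ := fun s =>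
    if h : ∃ t, (e t : Fin n) = s then (((a s : ℕ) : ℝ) + z h.choose) / k
    else max ((a s : ℕ) : ℝ) ((b s : ℕ) : ℝ) / k
  have hx : ∀ z ∈ unitCube i, x z ∈ subcube n k a ∩ subcube n k b := by
    intro z hz
    rw [mem_inter_iff, mem_subcube_iff, mem_subcube_iff, ← forall_and]
    intro s
    have hk : (k : ℝ) ≠ 0 := by
      have := (a s).pos
      positivity
    obtain ⟨h3, h4⟩ := hab s
    have h3' : ((a s : ℕ) : ℝ) ≤ (b s : ℕ) + 1 := by exact_mod_cast h3
    have h4' : ((b s : ℕ) : ℝ) ≤ (a s : ℕ) + 1 := by exact_mod_cast h4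
    by_cases h : ∃ t, (e t : Fin n) = s
    · have hs : a s = b s := by
        obtain ⟨t, rfl⟩ := h
        exact (e t).2
      have := hz h.choose
      simp only [x, dif_pos h]
      rw [div_mul_cancel₀ _ hk, ← hs]
      constructor <;> constructor <;> linarith
    · simp only [x, dif_neg h]
      rw [div_mul_cancel₀ _ hk]
      simp [h3', h4']
  have hxe : ∀ z t, x z (e t) = (((a (e t) : ℕ) : ℝ) + z t) / k := by
    intro z t
    have h : ∃ t', (e t' : Fin n) = e t := ⟨t, rfl⟩
    have h' : h.choose = t := e.injective (Subtype.ext h.choose_spec)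
    simp only [x, dif_pos h, h']
  refine Chessboard.le_coveringDimension (fun z => ⟨x z, hx z z.2⟩) ?_
    (fun y t => y.1 (e t) * k - ((a (e t) : ℕ) : ℝ)) ?_ ?_
  · refine Continuous.subtype_mk (continuous_pi fun s => ?_) _
    by_cases h : ∃ t, (e t : Fin n) = s
    · simp only [x, dif_pos h]
      exact (continuous_const.add ((continuous_apply _).comp continuous_subtype_val)).div_const _
    · simp only [x, dif_neg h]
      fun_prop
  · exact continuous_pi fun t =>
      (((continuous_apply _).comp continuous_subtype_val).mul_const _).sub continuous_const
  · intro z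
    funext t
    have hk : (k : ℝ) ≠ 0 := by
      have := (a (e t)).pos
      positivity
    simp only [hxe]
    rw [div_mul_cancel₀ _ hk, add_sub_cancel_left]

/-- The points of a subcube that have at least `i` coordinates in the interior of the
corresponding edge. -/
def core (n k i : ℕ) (a : Fin n → Fin k) : Set (Fin n → ℝ) :=
  {x ∈ subcube n k a | i ≤ {s | ((a s : ℕ) : ℝ) < x s * k ∧ x s * k < (a s : ℕ) + 1}.ncard}

lemma subcube_subset_unitCube {n k : ℕ} (a : Fin n → Fin k) : subcube n k a ⊆ unitCube n := by
  intro x hx s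
  rw [mem_subcube_iff] at hx
  have hk : (0 : ℝ) < k := by
    have := (a s).pos
    positivity
  have h1 : ((a s : ℕ) : ℝ) + 1 ≤ k := by exact_mod_cast (a s).2
  have h2 : (0 : ℝ) ≤ ((a s : ℕ) : ℝ) := Nat.cast_nonneg _
  obtain ⟨h3, h4⟩ := hx s
  constructor
  · exact nonneg_of_mul_nonneg_left (h2.trans h3) hk
  · nlinarith

/-- A coordinate strictly between consecutive grid values is not an endpoint for any subcube. So `i`
interior and `n - i + 1` endpoint coordinates would exceed `n`. -/
lemma core_disjoint_skeleton {n k i : ℕ} (a : Fin n → Fin k) :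
    Disjoint (core n k i a) (skeleton n k ((i : ℤ) - 1)) := by
  rw [Set.disjoint_left]
  rintro x ⟨-, hx⟩ hsk
  obtain ⟨b, -, S, hS, hSx⟩ := mem_iUnion.1 hsk
  have hdisj : Disjoint {s | ((a s : ℕ) : ℝ) < x s * k ∧ x s * k < (a s : ℕ) + 1}
      (S : Set (Fin n)) := by
    rw [Set.disjoint_left]
    rintro s ⟨h1, h2⟩ hs
    have hk : (k : ℝ) ≠ 0 := by
      have := (a s).pos
      positivity
    rcases hSx s hs with h | h <;> rw [h, div_mul_cancel₀ _ hk] at h1 h2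
    · have h1' : (a s : ℕ) < (b s : ℕ) := by exact_mod_cast h1
      have h2' : (b s : ℕ) < (a s : ℕ) + 1 := by exact_mod_cast h2
      omega
    · have h1' : (a s : ℕ) < (b s : ℕ) + 1 := by exact_mod_cast h1
      have h2' : (b s : ℕ) + 1 < (a s : ℕ) + 1 := by exact_mod_cast h2
      omega
  have h := Set.ncard_union_eq hdisj
  have h' := Set.ncard_le_ncard (subset_univ
    ({s | ((a s : ℕ) : ℝ) < x s * k ∧ x s * k < (a s : ℕ) + 1} ∪ (S : Set (Fin n))))
  rw [h, Set.ncard_univ, Nat.card_eq_fintype_card, Fintype.card_fin, Set.ncard_coe_finset] at h'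
  omega

/-- The core is star-shaped about the centre of the cube: any move towards it makes every coordinate
interior. -/
lemma isConnected_core {n k i : ℕ} (hi : i ≤ n) (a : Fin n → Fin k) :
    IsConnected (core n k i a) := by
  let c : Fin n → ℝ := fun s => ((a s : ℕ) + 1 / 2) / k
  have hc : ∀ s, c s * k = (a s : ℕ) + 1 / 2 := fun s => by
    have hk : (k : ℝ) ≠ 0 := by
      have := (a s).pos
      positivity
    simp only [c]
    rw [div_mul_cancel₀ _ hk]
  have hmem : ∀ x ∈ subcube n k a, ∀ t : ℝ, 0 < t → t ≤ 1 → ∀ s,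
      ((a s : ℕ) : ℝ) < (t * c s + (1 - t) * x s) * k ∧
        (t * c s + (1 - t) * x s) * k < (a s : ℕ) + 1 := by
    intro x hx t ht ht1 s
    obtain ⟨h1, h2⟩ := (mem_subcube_iff a x).1 hx s
    have e : (t * c s + (1 - t) * x s) * k = t * ((a s : ℕ) + 1 / 2) + (1 - t) * (x s * k) := by
      rw [← hc s]
      ring
    rw [e]
    constructor <;> nlinarith
  have hcs : c ∈ subcube n k a := by
    rw [mem_subcube_iff]
    intro s
    rw [hc s]
    constructor <;> linarith
  have hstar : ∀ x ∈ subcube n k a, ∀ t : ℝ, 0 < t → t ≤ 1 → t • c + (1 - t) • x ∈ core n k i a := by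
    intro x hx t ht ht1
    have h := hmem x hx t ht ht1
    refine ⟨(mem_subcube_iff _ _).2 fun s => ⟨(h s).1.le, (h s).2.le⟩, ?_⟩
    have : {s | ((a s : ℕ) : ℝ) < (t • c + (1 - t) • x) s * k ∧
        (t • c + (1 - t) • x) s * k < (a s : ℕ) + 1} = univ := eq_univ_of_forall h
    rw [this, Set.ncard_univ, Nat.card_eq_fintype_card, Fintype.card_fin]
    exact hi
  have hne : c ∈ core n k i a := by simpa using hstar c hcs 1 one_pos le_rfl
  refine (StarConvex.isPathConnected (a := c) ?_ hne).isConnected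
  intro x hx t u ht hu htu
  rcases ht.eq_or_lt with rfl | ht
  · have : u = 1 := by linarith
    simpa [this] using hx
  · have : u = 1 - t := by linarith
    rw [this]
    exact hstar x hx.1 t ht (by linarith)

/-- A common point takes midpoints where the indices agree and the shared grid value elsewhere. -/
lemma Adjacent.core_inter_nonempty {n k i : ℕ} {a b : Fin n → Fin k} (h : Adjacent i a b) :
    (core n k i a ∩ core n k i b).Nonempty := by
  let y : Fin n → ℝ := fun s => if a s = b s then (a s : ℕ) + 1 / 2 else
    max ((a s : ℕ) : ℝ) ((b s : ℕ) : ℝ)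
  have hy : ∀ s, y s / k * k = y s := fun s => by
    have hk : (k : ℝ) ≠ 0 := by
      have := (a s).pos
      positivity
    rw [div_mul_cancel₀ _ hk]
  have h1 : ∀ s, (((a s : ℕ) : ℝ) ≤ y s ∧ y s ≤ (a s : ℕ) + 1) ∧
      (((b s : ℕ) : ℝ) ≤ y s ∧ y s ≤ (b s : ℕ) + 1) := by
    intro s
    obtain ⟨h3, h4⟩ := h.1 s
    have h3' : ((a s : ℕ) : ℝ) ≤ (b s : ℕ) + 1 := by exact_mod_cast h3
    have h4' : ((b s : ℕ) : ℝ) ≤ (a s : ℕ) + 1 := by exact_mod_cast h4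
    simp only [y]
    split_ifs with hs
    · rw [← hs]
      norm_num
    · simp [h3', h4']
  refine ⟨fun s => y s / k, ⟨(mem_subcube_iff _ _).2 fun s => ?_, ?_⟩,
    ⟨(mem_subcube_iff _ _).2 fun s => ?_, ?_⟩⟩
  · rw [hy]
    exact (h1 s).1
  · refine h.2.trans (Set.ncard_le_ncard (fun s hs => ?_))
    simp only [mem_ofPred_eq] at hs ⊢
    rw [hy]
    simp only [y, if_pos hs]
    norm_num
  · rw [hy]
    exact (h1 s).2
  · refine h.2.trans (Set.ncard_le_ncard (fun s hs => ?_))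
    simp only [mem_ofPred_eq] at hs ⊢
    rw [hy]
    simp only [y, if_pos hs]
    rw [hs]
    norm_num

lemma core_inter_hyperplane_nonempty {n k : ℕ} (i : Fin n) (a : Fin n → Fin k) {c : ℝ}
    (h1 : ((a i : ℕ) : ℝ) ≤ c * k) (h2 : c * k ≤ (a i : ℕ) + 1) :
    (core n k i a ∩ {z | z i = c}).Nonempty := by
  let x : Fin n → ℝ := Function.update (fun s => ((a s : ℕ) + 1 / 2) / k) i c
  have hx : ∀ s ≠ i, x s * k = (a s : ℕ) + 1 / 2 := fun s hs => by
    have hk : (k : ℝ) ≠ 0 := by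
      have := (a s).pos
      positivity
    simp only [x, Function.update_of_ne hs]
    rw [div_mul_cancel₀ _ hk]
  have hxi : x i = c := by simp [x]
  refine ⟨x, ⟨(mem_subcube_iff _ _).2 fun s => ?_, ?_⟩, hxi⟩
  · rcases eq_or_ne s i with rfl | hs
    · rw [hxi]
      exact ⟨h1, h2⟩
    · rw [hx s hs]
      constructor <;> linarith
  · have h : ({i}ᶜ : Set (Fin n)).ncard ≤
        {s | ((a s : ℕ) : ℝ) < x s * k ∧ x s * k < (a s : ℕ) + 1}.ncard := by
      refine Set.ncard_le_ncard fun s hs => ?_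
      simp only [mem_ofPred_eq]
      rw [hx s hs]
      constructor <;> linarith
    refine le_trans ?_ h
    rw [Set.ncard_compl, Set.ncard_singleton, Nat.card_eq_fintype_card, Fintype.card_fin]
    omega

lemma core_inter_faceMinus_nonempty {n k : ℕ} {i : Fin n} {a : Fin n → Fin k}
    (h : (a i : ℕ) = 0) : (core n k i a ∩ faceMinus n i).Nonempty := by
  obtain ⟨x, hx, hxi⟩ := core_inter_hyperplane_nonempty i a (c := 0) (by simp [h]) (by simp [h])
  exact ⟨x, hx, subcube_subset_unitCube a hx.1, hxi⟩

lemma core_inter_facePlus_nonempty {n k : ℕ} {i : Fin n} {a : Fin n → Fin k}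
    (h : (a i : ℕ) + 1 = k) : (core n k i a ∩ facePlus n i).Nonempty := by
  have h' : ((a i : ℕ) : ℝ) + 1 = k := by exact_mod_cast h
  obtain ⟨x, hx, hxi⟩ := core_inter_hyperplane_nonempty i a (c := 1) (by linarith) (by linarith)
  exact ⟨x, hx, subcube_subset_unitCube a hx.1, hxi⟩

lemma exists_path_of_reflTransGen {α : Type*} {R : α → α → Prop} {a b : α}
    (h : Relation.ReflTransGen R a b) : ∃ (r : ℕ) (P : Fin (r + 1) → α),
      P 0 = a ∧ P (Fin.last r) = b ∧ ∀ j : Fin r, R (P j.castSucc) (P j.succ) := by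
  induction h using Relation.ReflTransGen.head_induction_on with
  | refl => exact ⟨0, fun _ => b, rfl, rfl, fun j => j.elim0⟩
  | @head a c hac _ ih =>
    obtain ⟨r, P, h0, h1, h2⟩ := ih
    refine ⟨r + 1, Fin.cons a P, rfl, ?_, fun j => ?_⟩
    · rw [← Fin.succ_last, Fin.cons_succ, h1]
    · induction j using Fin.cases with
      | zero => simpa [h0] using hac
      | succ j => simpa [← Fin.succ_castSucc] using h2 j

end Chessboard

/-! ### Both conclusions from one chain -/

theorem mainTheorem2 (n k : ℕ) (hn : 1 ≤ n) (hk : 1 ≤ k)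
    (F : Chessboard.subcubes n k → Fin n) :
    (∃ i : Fin n,
      Chessboard.colourUnion F i \ Chessboard.skeleton n k (((i : ℕ) : ℤ) - 1)
        ∈ Chessboard.Conn n i) ∧
    (∃ i : Fin n, ∃ r : ℕ, ∃ P : Fin (r + 1) → Chessboard.subcubes n k,
      (∀ j, F (P j) = i) ∧
      ((P 0 : Set (Fin n → ℝ)) ∩ Chessboard.faceMinus n i).Nonempty ∧
      ((P (Fin.last r) : Set (Fin n → ℝ)) ∩ Chessboard.facePlus n i).Nonempty ∧
      ∀ j : Fin r, (((i : ℕ) : ℕ∞) : WithBot ℕ∞) ≤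
        coveringDimension
          ((P j.castSucc : Set (Fin n → ℝ)) ∩ (P j.succ : Set (Fin n → ℝ)) : Set (Fin n → ℝ))) := by
  open Chessboard in
  let Q (a : Fin n → Fin k) : subcubes n k := ⟨subcube n k a, a, rfl⟩
  obtain ⟨i, a, b, hFa, ha, hb, hab⟩ := exists_chain_of_colouring hk fun a => F (Q a)
  refine ⟨⟨i, ?_, ?_⟩, i, ?_⟩
  · rintro x ⟨hx, -⟩
    obtain ⟨P, -, hxP⟩ := mem_iUnion₂.1 hx
    obtain ⟨_, c, rfl⟩ := P
    exact subcube_subset_unitCube c hxP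
  · have hcore : ∀ c, F (Q c) = i →
        core n k i c ⊆ colourUnion F i \ skeleton n k (((i : ℕ) : ℤ) - 1) := by
      intro c hc x hx
      exact ⟨mem_iUnion₂.2 ⟨Q c, hc, hx.1⟩, Set.disjoint_left.1 (core_disjoint_skeleton c) hx⟩
    have key : ∃ S ⊆ colourUnion F i \ skeleton n k (((i : ℕ) : ℤ) - 1), IsConnected S ∧
        core n k i a ⊆ S ∧ core n k i b ⊆ S := by
      clear hb
      induction hab with
      | refl => exact ⟨_, hcore a hFa, isConnected_core i.2.le a, subset_rfl, subset_rfl⟩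
      | @tail b c _ hbc ih =>
        obtain ⟨S, hS, hconn, hSa, hSb⟩ := ih
        refine ⟨S ∪ core n k i c, union_subset hS (hcore c hbc.1), ?_,
          hSa.trans subset_union_left, subset_union_right⟩
        exact hconn.union (hbc.2.core_inter_nonempty.mono (inter_subset_inter_left _ hSb))
          (isConnected_core i.2.le c)
    obtain ⟨S, hS, hconn, hSa, hSb⟩ := key
    exact ⟨S, hS, hconn, (core_inter_faceMinus_nonempty ha).mono (inter_subset_inter_left _ hSa),
      (core_inter_facePlus_nonempty hb).mono (inter_subset_inter_left _ hSb)⟩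
  · obtain ⟨r, P, hP0, hPr, hP⟩ := exists_path_of_reflTransGen hab
    refine ⟨r, fun j => Q (P j), fun j => ?_, ?_, ?_, fun j => (hP j).2.le_coveringDimension⟩
    · induction j using Fin.cases with
      | zero => simpa only [hP0] using hFa
      | succ j => exact (hP j).1
    · simp only [hP0]
      exact (core_inter_faceMinus_nonempty ha).mono (inter_subset_inter_left _ fun x hx => hx.1)
    · simp only [hPr]
      exact (core_inter_facePlus_nonempty hb).mono (inter_subset_inter_left _ fun x hx => hx.1)
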